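/- Let $\mathcal B$ be a separable complex Banach space, let $A_1,\dots,A_p$ and $B_0,\dots,B_q$ be continuous linear operators on $\mathcal B$, and let $(Z_t)_{t\in\mathbb Z}$ be an i.i.d. sequence of $\mathcal B$-valued random variables with $\mathbb E\log^+\|Z_0\|<\infty$. Put \[ Q(z)=z^p\,\mathrm{id}-z^{p-1}A_1-\cdots-zA_{p-1}-A_p \] and assume that $Q(z)$ is invertible for every $z\in\mathbb C$ with $|z|=1$. Let \[ F(z)=(\mathrm{id}-zA_1-z^2A_2-\cdots-z^pA_p)^{-1}(B_0+zB_1+\cdots+z^qB_q). \] Then the inverse in the definition of $F$ exists, and $F$ is holomorphic, on some annulus $\{r<|z|<R\}$ with $0\le r<1<R$; there $F$ is the sum of an absolutely convergent Laurent series $F(z)=\sum_{k\in\mathbb Z}z^k\psi_k$, whose coefficients (continuous linear operators on $\mathcal B$) do not depend on the choice of such an annulus around the unit circle and are given by \[ \psi_n=\frac1{2\pi i}\oint_{|z|=1}z^{-n-1}F(z)\,dz,\qquad n\in\mathbb Z . \] For every $t\in\mathbb Z$ the series \[ Y_t=\sum_{k=-\infty}^{\infty}\psi_kZ_{t-k}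 \] converges almost surely absolutely, and $(Y_t)_{t\in\mathbb Z}$ is a strictly stationary solution of the ARMA($p$,$q$) equation \[ Y_t-A_1Y_{t-1}-\cdots-A_pY_{t-p}=B_0Z_t+\cdots+B_qZ_{t-q}\quad\text{a.s.},\qquad t\in\mathbb Z . \] It is the unique one: every strictly stationary solution, defined on the same probability space as $(Z_t)$, coincides with it almost surely. -/

import Mathlib

open MeasureTheory ProbabilityTheory Real

namespace ARMA

noncomputable section

/-- The operator polynomial `Q(z) = z ^ p id - z ^ (p - 1) A₁ - ⋯ - z A_{p-1} - A_p`.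
Only the operators `A 1, …, A p` are used. -/
def charPoly {E : Type*} [NormedAddCommGroup E] [NormedSpace ℂ E]
    (p : ℕ) (A : ℕ → E →L[ℂ] E) (z : ℂ) : E →L[ℂ] E :=
  z ^ p • ContinuousLinearMap.id ℂ E - ∑ j ∈ Finset.Icc 1 p, z ^ (p - j) • A j

/-- The autoregressive polynomial `id - z A₁ - z ^ 2 A₂ - ⋯ - z ^ p A_p`. -/
def arPoly {E : Type*} [NormedAddCommGroup E] [NormedSpace ℂ E]
    (p : ℕ) (A : ℕ → E →L[ℂ] E) (z : ℂ) : E →L[ℂ] E :=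
  ContinuousLinearMap.id ℂ E - ∑ j ∈ Finset.Icc 1 p, z ^ j • A j

/-- The moving average polynomial `B₀ + z B₁ + ⋯ + z ^ q B_q`.
Only the operators `B 0, …, B q` are used. -/
def maPoly {E : Type*} [NormedAddCommGroup E] [NormedSpace ℂ E]
    (q : ℕ) (B : ℕ → E →L[ℂ] E) (z : ℂ) : E →L[ℂ] E :=
  ∑ k ∈ Finset.range (q + 1), z ^ k • B k

/-- The operator-valued function
`(id - z A₁ - ⋯ - z ^ p A_p)⁻¹ (B₀ + z B₁ + ⋯ + z ^ q B_q)`; the inverse is the inverse in the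
algebra of continuous linear operators (`0` by convention where it does not exist). -/
def transfer {E : Type*} [NormedAddCommGroup E] [NormedSpace ℂ E]
    (p q : ℕ) (A B : ℕ → E →L[ℂ] E) (z : ℂ) : E →L[ℂ] E :=
  Ring.inverse (arPoly p A z) * maPoly q B z

/-- The open annulus `{z : r < |z| < R}`. -/
def annulus (r R : ℝ) : Set ℂ := {z | r < ‖z‖ ∧ ‖z‖ < R}

/-- `ψ` is the family of coefficients of a Laurent series which converges absolutely to `f`
at every point of the annulus `{z : r < |z| < R}`. -/
def HasLaurentSeriesOn {F : Type*} [NormedAddCommGroup F] [NormedSpace ℂ F]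
    (f : ℂ → F) (ψ : ℤ → F) (r R : ℝ) : Prop :=
  ∀ z ∈ annulus r R,
    Summable (fun k : ℤ => ‖z ^ k • ψ k‖) ∧ HasSum (fun k : ℤ => z ^ k • ψ k) (f z)

/-- Strict white noise: an i.i.d. sequence of `E`-valued random variables indexed by `ℤ`. -/
structure IsStrictWhiteNoise {Ω E : Type*} [MeasurableSpace Ω] [MeasurableSpace E]
    (Z : ℤ → Ω → E) (P : Measure Ω) : Prop where
  measurable : ∀ t, Measurable (Z t)
  indep : iIndepFun Z P
  identDistrib : ∀ t, IdentDistrib (Z t) (Z 0) P P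

/-- Strict stationarity: for every `h`, the process `(Y_{t+h})_t` has the same law
(on `ℤ → E` with the product σ-algebra) as `(Y_t)_t`. -/
structure IsStrictlyStationary {Ω E : Type*} [MeasurableSpace Ω] [MeasurableSpace E]
    (Y : ℤ → Ω → E) (P : Measure Ω) : Prop where
  measurable : ∀ t, Measurable (Y t)
  shift : ∀ h : ℤ, P.map (fun ω (t : ℤ) => Y (t + h) ω) = P.map (fun ω (t : ℤ) => Y t ω)

/-- `Y` solves `Y_t - A₁ Y_{t-1} - ⋯ - A_p Y_{t-p} = B₀ Z_t + ⋯ + B_q Z_{t-q}`, almost surely,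
for every integer `t`. -/
def IsSolution {Ω E : Type*} [MeasurableSpace Ω] [NormedAddCommGroup E] [NormedSpace ℂ E]
    (p q : ℕ) (A B : ℕ → E →L[ℂ] E) (Z Y : ℤ → Ω → E) (P : Measure Ω) : Prop :=
  ∀ t : ℤ, ∀ᵐ ω ∂P,
    Y t ω - ∑ j ∈ Finset.Icc 1 p, A j (Y (t - j) ω)
      = ∑ k ∈ Finset.range (q + 1), B k (Z (t - k) ω)

end

end ARMA

/-! The autoregressive polynomial is `z ^ p • Q(1/z)` for `z ≠ 0`, so it is invertible on the unit
circle and, units being open and the circle compact, on an annulus around it. There its inverse `D`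
and `F` are holomorphic, and both have Laurent series. Cauchy's estimates on one circle inside and
one outside the unit circle make the coefficients decay geometrically in `|k|`. By Borel–Cantelli
the logarithmic moment makes `‖Z_{t-k}‖` grow more slowly than any exponential in `|k|`, whence
absolute convergence. Comparing coefficients in `arPoly * F = maPoly` gives the recursion behind the
ARMA equation; stationarity holds because the filter commutes with shifts.

For uniqueness, the difference `w` of two solutions solves the homogeneous equation. Convolving it
over a window `[-n, n]` with the coefficients `d` of `D` reproduces `w t` up to boundary terms
(`eq_boundary_sum`), since `D * arPoly = 1`. These tend to zero in probability because `d` tends to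
zero and the marginal laws are fixed, so no moment of the solutions is required. -/

/-! ### Laurent expansion of vector-valued holomorphic functions -/

section Laurent

variable {X : Type*} [NormedAddCommGroup X] [NormedSpace ℂ X]

/-- Termwise integration over a circle of a uniformly dominated series. -/
theorem hasSum_circleIntegral_of_summable_bound {ι : Type*} [Countable ι] {ρ : ℝ} (hρ : 0 ≤ ρ)
    {f : ι → ℂ → X} {g : ℂ → X} {b : ι → ℝ} (hb : Summable b)
    (hf : ∀ i, ContinuousOn (f i) (Metric.sphere 0 ρ))
    (hle : ∀ i, ∀ z ∈ Metric.sphere (0 : ℂ) ρ, ‖f i z‖ ≤ b i)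
    (hsum : ∀ z ∈ Metric.sphere (0 : ℂ) ρ, HasSum (fun i => f i z) (g z)) :
    HasSum (fun i => ∮ z in C(0, ρ), f i z) (∮ z in C(0, ρ), g z) := by
  have hmem : ∀ θ, circleMap 0 ρ θ ∈ Metric.sphere (0 : ℂ) ρ := circleMap_mem_sphere 0 hρ
  refine intervalIntegral.hasSum_integral_of_dominated_convergence (fun i _ => ρ * b i)
    (fun i => ?_) (fun i => ?_) ?_ ?_ ?_
  · refine Continuous.aestronglyMeasurable ?_
    refine Continuous.smul ?_ ((hf i).comp_continuous (continuous_circleMap 0 ρ) hmem)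
    rw [show deriv (circleMap 0 ρ) = fun θ => circleMap 0 ρ θ * Complex.I from
      funext fun θ => deriv_circleMap 0 ρ θ]
    fun_prop
  · refine Filter.Eventually.of_forall fun θ _ => ?_
    rw [norm_smul]
    simp only [deriv_circleMap, norm_mul, Complex.norm_I, mul_one, norm_circleMap_zero,
      abs_of_nonneg hρ]
    exact mul_le_mul_of_nonneg_left (hle i _ (hmem θ)) hρ
  · exact Filter.Eventually.of_forall fun θ _ => hb.mul_left ρ
  · exact intervalIntegrable_const
  · exact Filter.Eventually.of_forall fun θ _ => (hsum _ (hmem θ)).const_smul _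

/-- The `n`-th Laurent coefficient of `f`, as a contour integral over the unit circle. -/
noncomputable def laurentCoeff (f : ℂ → X) (n : ℤ) : X :=
  (2 * (π : ℂ) * Complex.I)⁻¹ • ∮ z in C(0, 1), z ^ (-n - 1) • f z

theorem ne_zero_of_mem_sphere_one {z : ℂ} (hz : z ∈ Metric.sphere (0 : ℂ) 1) : z ≠ 0 :=
  Metric.ne_of_mem_sphere hz one_ne_zero

theorem circleIntegral_zpow_smul_const [CompleteSpace X] (m : ℤ) (a : X) :
    (∮ z in C(0, 1), z ^ m • a) = if m = -1 then (2 * (π : ℂ) * Complex.I) • a else 0 := by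
  rw [circleIntegral.integral_smul_const]
  split_ifs with h
  · subst h
    congr 1
    simpa using circleIntegral.integral_sub_center_inv (0 : ℂ) (R := 1) one_ne_zero
  · have := circleIntegral.integral_sub_zpow_of_ne h 0 0 1
    simp only [sub_zero] at this
    rw [this, zero_smul]

/-- The coefficients of a doubly infinite series converging absolutely on the unit circle are the
Laurent coefficients of its sum. -/
theorem eq_laurentCoeff_of_hasSum [CompleteSpace X] {φ : ℤ → X} {f : ℂ → X}
    (hφ : Summable fun k => ‖φ k‖)
    (hf : ∀ z : ℂ, ‖z‖ = 1 → HasSum (fun k : ℤ => z ^ k • φ k) (f z)) (n : ℤ) :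
    φ n = laurentCoeff f n := by
  have hs : HasSum (fun k : ℤ => ∮ z in C(0, 1), z ^ (-n - 1) • z ^ k • φ k)
      (∮ z in C(0, 1), z ^ (-n - 1) • f z) := by
    refine hasSum_circleIntegral_of_summable_bound zero_le_one hφ (fun k => ?_) (fun k z hz => ?_)
      (fun z hz => ?_)
    · have hz : ∀ m : ℤ, ContinuousOn (fun z : ℂ => z ^ m) (Metric.sphere 0 1) := fun m =>
        continuousOn_id.zpow₀ m fun z hz => Or.inl (ne_zero_of_mem_sphere_one hz)
      exact (hz _).smul ((hz k).smul continuousOn_const)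
    · have : ‖z‖ = 1 := by simpa using hz
      simp [norm_smul, this]
    · exact (hf z (by simpa using hz)).const_smul _
  have hval : ∀ k : ℤ, (∮ z in C(0, 1), z ^ (-n - 1) • z ^ k • φ k)
      = if k = n then (2 * (π : ℂ) * Complex.I) • φ n else 0 := by
    intro k
    have h1 : (∮ z in C(0, 1), z ^ (-n - 1) • z ^ k • φ k)
        = ∮ z in C(0, 1), z ^ (-n - 1 + k) • φ k :=
      circleIntegral.integral_congr zero_le_one fun z hz => by
        simp only [smul_smul]
        rw [← zpow_add₀ (ne_zero_of_mem_sphere_one hz)]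
    rw [h1, circleIntegral_zpow_smul_const]
    by_cases h : k = n
    · rw [if_pos (by omega), if_pos h, h]
    · rw [if_neg (by omega), if_neg h]
  simp only [hval] at hs
  have := hs.unique (hasSum_ite_eq n ((2 * (π : ℂ) * Complex.I) • φ n))
  rw [laurentCoeff, this, smul_smul, inv_mul_cancel₀ Complex.two_pi_I_ne_zero, one_smul]

namespace ARMA

theorem isOpen_annulus (r R : ℝ) : IsOpen (annulus r R) :=
  (isOpen_lt continuous_const continuous_norm).inter (isOpen_lt continuous_norm continuous_const)

theorem ne_zero_of_mem_annulus {r R : ℝ} (hr : 0 ≤ r) {z : ℂ} (hz : z ∈ annulus r R) : z ≠ 0 :=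
  norm_pos_iff.1 (hr.trans_lt hz.1)

theorem circleIntegral_eq_of_differentiableOn_annulus {r R : ℝ} (hr : 0 ≤ r) {f : ℂ → X}
    (hf : DifferentiableOn ℂ f (annulus r R)) {ρ σ : ℝ} (hρ : r < ρ) (hρσ : ρ ≤ σ) (hσ : σ < R) :
    (∮ z in C(0, σ), f z) = ∮ z in C(0, ρ), f z := by
  refine Complex.circleIntegral_eq_of_differentiable_on_annulus_off_countable (s := ∅)
    (hr.trans_lt hρ) hρσ Set.countable_empty (hf.continuousOn.mono ?_) ?_
  · rintro z ⟨h1, h2⟩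
    simp only [Metric.mem_closedBall, dist_zero_right, Metric.mem_ball, not_lt] at h1 h2
    exact ⟨hρ.trans_le h2, h1.trans_lt hσ⟩
  · rintro z ⟨⟨h1, h2⟩, -⟩
    simp only [Metric.mem_closedBall, dist_zero_right, Metric.mem_ball, not_le] at h1 h2
    exact (hf z ⟨hρ.trans h2, h1.trans hσ⟩).differentiableAt
      ((isOpen_annulus r R).mem_nhds ⟨hρ.trans h2, h1.trans hσ⟩)

/-- Cauchy's integral formula on an annulus. -/
theorem circleIntegral_sub_circleIntegral_eq [CompleteSpace X] {r R : ℝ} (hr : 0 ≤ r) {f : ℂ → X}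
    (hf : DifferentiableOn ℂ f (annulus r R)) {ρ σ : ℝ} {w : ℂ} (hρ : r < ρ) (hρw : ρ < ‖w‖)
    (hwσ : ‖w‖ < σ) (hσ : σ < R) :
    (∮ z in C(0, σ), (z - w)⁻¹ • f z) - (∮ z in C(0, ρ), (z - w)⁻¹ • f z)
      = (2 * (π : ℂ) * Complex.I) • f w := by
  have hρ0 : 0 < ρ := hr.trans_lt hρ
  have hσ0 : 0 < σ := hρ0.trans (hρw.trans hwσ)
  have hw : annulus r R ∈ nhds w :=
    (isOpen_annulus r R).mem_nhds ⟨hρ.trans hρw, hwσ.trans hσ⟩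
  -- The divided difference is holomorphic across `w`, so its integrals over the two circles agree;
  -- splitting it on each circle gives the formula.
  have hd : DifferentiableOn ℂ (dslope f w) (annulus r R) :=
    (Complex.differentiableOn_dslope hw).2 hf
  have key := circleIntegral_eq_of_differentiableOn_annulus hr hd hρ (hρw.trans hwσ).le hσ
  have hne : ∀ τ : ℝ, τ ≠ ‖w‖ → ∀ z ∈ Metric.sphere (0 : ℂ) τ, z ≠ w := by
    rintro τ hτ z hz rfl
    exact hτ (by simpa using hz.symm)
  have hint : ∀ τ : ℝ, r < τ → τ < R → τ ≠ ‖w‖ →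
      (∮ z in C(0, τ), dslope f w z)
        = (∮ z in C(0, τ), (z - w)⁻¹ • f z) - (∮ z in C(0, τ), (z - w)⁻¹) • f w := by
    intro τ h1 h2 h3
    have hτ : 0 ≤ τ := hr.trans h1.le
    have hinv : ContinuousOn (fun z : ℂ => (z - w)⁻¹) (Metric.sphere 0 τ) :=
      (continuousOn_id.sub continuousOn_const).inv₀ fun z hz => sub_ne_zero.2 (hne τ h3 z hz)
    have hfc : ContinuousOn f (Metric.sphere 0 τ) := hf.continuousOn.mono fun z hz => by
      have : ‖z‖ = τ := by simpa using hz
      exact ⟨this ▸ h1, this ▸ h2⟩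
    have hsub := circleIntegral.integral_sub (f := fun z => (z - w)⁻¹ • f z)
      (g := fun z => (z - w)⁻¹ • f w)
      ((hinv.smul hfc).circleIntegrable hτ) ((hinv.smul continuousOn_const).circleIntegrable hτ)
    rw [← circleIntegral.integral_smul_const, ← hsub]
    refine circleIntegral.integral_congr hτ fun z hz => ?_
    rw [dslope_of_ne _ (hne τ h3 z hz), slope_def_module, smul_sub]
  rw [hint σ (hρ.trans (hρw.trans hwσ)) hσ hwσ.ne', hint ρ hρ (hρw.trans (hwσ.trans hσ)) hρw.ne,
    circleIntegral.integral_sub_inv_of_mem_ball (by simpa using hwσ)] at key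
  have hzero : (∮ z in C(0, ρ), (z - w)⁻¹) = 0 := by
    refine DiffContOnCl.circleIntegral_eq_zero hρ0.le (DifferentiableOn.diffContOnCl ?_)
    intro z hz
    refine ((differentiableAt_id.sub_const w).inv ?_).differentiableWithinAt
    have hz' := Metric.closure_ball_subset_closedBall hz
    rw [id, sub_ne_zero]
    rintro rfl
    rw [mem_closedBall_zero_iff] at hz'
    exact absurd hρw (not_lt.2 hz')
  rw [hzero, zero_smul, sub_zero] at key
  rw [← key]
  abel

/-- Deforming the contour lets coefficients defined on the unit circle be estimated on whichever
circle of the annulus suits the sign of the index. -/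
theorem circleIntegral_zpow_smul_eq {r R : ℝ} (hr : 0 ≤ r) (hr1 : r < 1) (hR1 : 1 < R) {f : ℂ → X}
    (hf : DifferentiableOn ℂ f (annulus r R)) {ρ : ℝ} (hρ : r < ρ) (hρR : ρ < R) (m : ℤ) :
    (∮ z in C(0, ρ), z ^ m • f z) = ∮ z in C(0, 1), z ^ m • f z := by
  have hd : DifferentiableOn ℂ (fun z : ℂ => z ^ m • f z) (annulus r R) := fun z hz =>
    (differentiableAt_zpow.2 (Or.inl (ne_zero_of_mem_annulus hr hz))).differentiableWithinAt.smul
      (hf z hz)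
  rcases le_total ρ 1 with h | h
  · exact (circleIntegral_eq_of_differentiableOn_annulus hr hd hρ h hR1).symm
  · exact circleIntegral_eq_of_differentiableOn_annulus hr hd hr1 h hρR

/-- Cauchy's estimate for the Laurent coefficients. -/
theorem exists_norm_laurentCoeff_le {r R : ℝ} (hr : 0 ≤ r) (hr1 : r < 1) (hR1 : 1 < R) {f : ℂ → X}
    (hf : DifferentiableOn ℂ f (annulus r R)) {ρ : ℝ} (hρ : r < ρ) (hρR : ρ < R) :
    ∃ M : ℝ, 0 ≤ M ∧ (∀ z ∈ Metric.sphere (0 : ℂ) ρ, ‖f z‖ ≤ M) ∧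
      ∀ n : ℤ, ‖laurentCoeff f n‖ ≤ M * ρ ^ (-n) := by
  have hρ0 : 0 < ρ := hr.trans_lt hρ
  have hfc : ContinuousOn f (Metric.sphere 0 ρ) := hf.continuousOn.mono fun z hz => by
    have : ‖z‖ = ρ := by simpa using hz
    exact ⟨this ▸ hρ, this ▸ hρR⟩
  obtain ⟨M, hM⟩ := (isCompact_sphere (0 : ℂ) ρ).exists_bound_of_continuousOn hfc
  refine ⟨max M 0, le_max_right _ _, fun z hz => (hM z hz).trans (le_max_left _ _), fun n => ?_⟩
  rw [laurentCoeff, ← circleIntegral_zpow_smul_eq hr hr1 hR1 hf hρ hρR]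
  refine (circleIntegral.norm_two_pi_i_inv_smul_integral_le_of_norm_le_const
    (C := ρ ^ (-n - 1) * max M 0) hρ0.le fun z hz => ?_).trans_eq ?_
  · have : ‖z‖ = ρ := by simpa using hz
    rw [norm_smul, norm_zpow, this]
    exact mul_le_mul_of_nonneg_left ((hM z hz).trans (le_max_left _ _)) (zpow_nonneg hρ0.le _)
  · rw [zpow_sub_one₀ hρ0.ne']
    field_simp

theorem summable_int_of_le_geometric {a : ℤ → ℝ} (ha : ∀ k, 0 ≤ a k) {C x D y : ℝ} (hx : 0 ≤ x)
    (hx1 : x < 1) (hy : 0 ≤ y) (hy1 : y < 1) (h1 : ∀ n : ℕ, a n ≤ C * x ^ n)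
    (h2 : ∀ n : ℕ, a (-(n + 1 : ℤ)) ≤ D * y ^ (n + 1)) : Summable a := by
  refine Summable.of_nat_of_neg_add_one ?_ ?_
  · exact Summable.of_nonneg_of_le (fun n => ha _) h1
      ((summable_geometric_of_lt_one hx hx1).mul_left C)
  · exact Summable.of_nonneg_of_le (fun n => ha _) h2
      (((summable_nat_add_iff 1).2 (summable_geometric_of_lt_one hy hy1)).mul_left D)

theorem hasSum_pow_mul_zpow_neg {w z : ℂ} (h : ‖w‖ < ‖z‖) :
    HasSum (fun n : ℕ => w ^ n * z ^ (-(n : ℤ) - 1)) (z - w)⁻¹ := by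
  have hz : z ≠ 0 := norm_pos_iff.1 ((norm_nonneg w).trans_lt h)
  have hlt : ‖w / z‖ < 1 := by
    rw [norm_div]
    exact (div_lt_one (norm_pos_iff.2 hz)).2 h
  have h1 := (hasSum_geometric_of_norm_lt_one hlt).mul_right z⁻¹
  have h2 : (1 - w / z)⁻¹ * z⁻¹ = (z - w)⁻¹ := by
    rw [← mul_inv, sub_mul, one_mul, div_mul_cancel₀ _ hz]
  rw [h2] at h1
  refine h1.congr_fun fun n => ?_
  rw [zpow_sub_one₀ hz, zpow_neg, zpow_natCast, div_pow, div_eq_mul_inv, mul_assoc]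

/-- **Laurent expansion** of a holomorphic function on an annulus around the unit circle. -/
theorem hasLaurentSeriesOn_laurentCoeff [CompleteSpace X] {r R : ℝ} (hr : 0 ≤ r) (hr1 : r < 1)
    (hR1 : 1 < R) {f : ℂ → X} (hf : DifferentiableOn ℂ f (annulus r R)) :
    HasLaurentSeriesOn f (laurentCoeff f) r R := by
  intro w hw
  obtain ⟨ρ, hρ, hρw⟩ := exists_between hw.1
  obtain ⟨σ, hwσ, hσ⟩ := exists_between hw.2
  have hρ0 : 0 < ρ := hr.trans_lt hρ
  have hw0 : 0 < ‖w‖ := hρ0.trans hρw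
  have hwne : w ≠ 0 := norm_pos_iff.1 hw0
  have hσ0 : 0 < σ := hw0.trans hwσ
  have hρR : ρ < R := hρw.trans hw.2
  have hrσ : r < σ := hw.1.trans hwσ
  obtain ⟨M, hM0, hM, hMc⟩ := exists_norm_laurentCoeff_le hr hr1 hR1 hf hρ hρR
  obtain ⟨N, hN0, hN, hNc⟩ := exists_norm_laurentCoeff_le hr hr1 hR1 hf hrσ hσ
  have hfc : ∀ τ : ℝ, r < τ → τ < R → ContinuousOn f (Metric.sphere 0 τ) := fun τ h1 h2 =>
    hf.continuousOn.mono fun z hz => by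
      have : ‖z‖ = τ := by simpa using hz
      exact ⟨this ▸ h1, this ▸ h2⟩
  have hz : ∀ τ : ℝ, 0 < τ → ∀ m : ℤ,
      ContinuousOn (fun z : ℂ => z ^ m) (Metric.sphere 0 τ) := fun τ hτ m =>
    continuousOn_id.zpow₀ m fun z hz => Or.inl (Metric.ne_of_mem_sphere hz hτ.ne')
  have hx1 : ‖w‖ / σ < 1 := (div_lt_one hσ0).2 hwσ
  have hy1 : ρ / ‖w‖ < 1 := (div_lt_one hw0).2 hρw
  constructor
  · refine summable_int_of_le_geometric (fun k => norm_nonneg _) (C := N) (x := ‖w‖ / σ) (D := M)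
      (y := ρ / ‖w‖) (by positivity) hx1 (by positivity) hy1 (fun n => ?_) (fun n => ?_)
    · rw [norm_smul, norm_zpow, zpow_natCast]
      refine (mul_le_mul_of_nonneg_left (hNc n) (by positivity)).trans_eq ?_
      rw [zpow_neg, zpow_natCast, div_pow]
      ring
    · rw [norm_smul, norm_zpow]
      refine (mul_le_mul_of_nonneg_left (hMc _) (by positivity)).trans_eq ?_
      rw [neg_neg, zpow_neg, div_pow]
      norm_cast
      ring
  -- On the outer circle `‖w‖ < ‖z‖`, so the Cauchy kernel expands in powers of `w / z` and yields
  -- the indices `k ≥ 0`.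
  · have houter : HasSum (fun n : ℕ => w ^ (n : ℤ) • ∮ z in C(0, 1), z ^ (-(n : ℤ) - 1) • f z)
        (∮ z in C(0, σ), (z - w)⁻¹ • f z) := by
      have := hasSum_circleIntegral_of_summable_bound (X := X) hσ0.le
        (f := fun (n : ℕ) z => w ^ (n : ℤ) • z ^ (-(n : ℤ) - 1) • f z)
        (g := fun z => (z - w)⁻¹ • f z) (b := fun n => (σ⁻¹ * N) * (‖w‖ / σ) ^ n)
        ((summable_geometric_of_lt_one (by positivity) hx1).mul_left _)
        (fun n => continuousOn_const.smul ((hz σ hσ0 _).smul (hfc σ hrσ hσ)))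
        (fun n z hzσ => ?_) (fun z hzσ => ?_)
      · refine this.congr_fun fun n => ?_
        rw [circleIntegral.integral_smul, circleIntegral_zpow_smul_eq hr hr1 hR1 hf hrσ hσ]
      · have hzn : ‖z‖ = σ := by simpa using hzσ
        rw [norm_smul, norm_smul, norm_zpow, norm_zpow, hzn, ← mul_assoc]
        refine (mul_le_mul_of_nonneg_left (hN z hzσ) (by positivity)).trans_eq ?_
        rw [zpow_sub_one₀ hσ0.ne', zpow_neg, zpow_natCast, zpow_natCast, div_pow]
        ring
      · have hzn : ‖z‖ = σ := by simpa using hzσ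
        refine ((hasSum_pow_mul_zpow_neg (hzn ▸ hwσ)).smul_const (f z)).congr_fun fun n => ?_
        rw [smul_smul, zpow_natCast]
    -- On the inner circle the roles of `w` and `z` are exchanged: powers of `z / w` yield the
    -- indices `k < 0`.
    have hinner : HasSum (fun n : ℕ => w ^ (-((n : ℤ) + 1)) •
          ∮ z in C(0, 1), z ^ (-(-((n : ℤ) + 1)) - 1) • f z)
        (∮ z in C(0, ρ), (w - z)⁻¹ • f z) := by
      have := hasSum_circleIntegral_of_summable_bound (X := X) hρ0.le
        (f := fun (n : ℕ) z => w ^ (-((n : ℤ) + 1)) • z ^ (-(-((n : ℤ) + 1)) - 1) • f z)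
        (g := fun z => (w - z)⁻¹ • f z) (b := fun n => (‖w‖⁻¹ * M) * (ρ / ‖w‖) ^ n)
        ((summable_geometric_of_lt_one (by positivity) hy1).mul_left _)
        (fun n => continuousOn_const.smul ((hz ρ hρ0 _).smul (hfc ρ hρ hρR)))
        (fun n z hzρ => ?_) (fun z hzρ => ?_)
      · refine this.congr_fun fun n => ?_
        rw [circleIntegral.integral_smul, circleIntegral_zpow_smul_eq hr hr1 hR1 hf hρ hρR]
      · have hzn : ‖z‖ = ρ := by simpa using hzρ
        rw [norm_smul, norm_smul, norm_zpow, norm_zpow, hzn, ← mul_assoc]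
        refine (mul_le_mul_of_nonneg_left (hM z hzρ) (by positivity)).trans_eq ?_
        rw [neg_neg, add_sub_cancel_right, neg_add', zpow_sub_one₀ hw0.ne', zpow_neg,
          zpow_natCast, zpow_natCast, div_pow]
        ring
      · have hzn : ‖z‖ = ρ := by simpa using hzρ
        refine ((hasSum_pow_mul_zpow_neg (hzn ▸ hρw)).smul_const (f z)).congr_fun fun n => ?_
        rw [smul_smul, neg_neg, add_sub_cancel_right, neg_add', zpow_natCast, mul_comm]
    have htot := (HasSum.of_nat_of_neg_add_one
      (f := fun k : ℤ => w ^ k • ∮ z in C(0, 1), z ^ (-k - 1) • f z) houter hinner).const_smul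
        (2 * (π : ℂ) * Complex.I)⁻¹
    have hval : (∮ z in C(0, ρ), (w - z)⁻¹ • f z) = -∮ z in C(0, ρ), (z - w)⁻¹ • f z := by
      rw [← neg_one_smul ℂ, ← circleIntegral.integral_smul]
      refine circleIntegral.integral_congr hρ0.le fun z _ => ?_
      rw [neg_one_smul, ← neg_smul, ← inv_neg, neg_sub]
    rw [hval, ← sub_eq_add_neg, circleIntegral_sub_circleIntegral_eq hr hf hρ hρw hwσ hσ,
      smul_smul, inv_mul_cancel₀ Complex.two_pi_I_ne_zero, one_smul] at htot
    refine htot.congr_fun fun k => ?_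
    rw [laurentCoeff, smul_comm]

end ARMA

end Laurent

namespace ARMA

/-! ### The transfer function and the recursions for its coefficients -/

section Filter

variable {E : Type*} [NormedAddCommGroup E] [NormedSpace ℂ E]

theorem arPoly_eq_smul_charPoly (p : ℕ) (A : ℕ → E →L[ℂ] E) {z : ℂ} (hz : z ≠ 0) :
    arPoly p A z = z ^ p • charPoly p A z⁻¹ := by
  rw [arPoly, charPoly, smul_sub, smul_smul, ← mul_pow, mul_inv_cancel₀ hz, one_pow, one_smul,
    Finset.smul_sum]
  congr 1
  refine Finset.sum_congr rfl fun j hj => ?_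
  rw [smul_smul, inv_pow, ← pow_sub₀ z hz (Nat.sub_le _ _), Nat.sub_sub_self (Finset.mem_Icc.1 hj).2]

theorem isUnit_arPoly_of_norm_eq_one {p : ℕ} {A : ℕ → E →L[ℂ] E}
    (hQ : ∀ z : ℂ, ‖z‖ = 1 → IsUnit (charPoly p A z)) {z : ℂ} (hz : ‖z‖ = 1) :
    IsUnit (arPoly p A z) := by
  have hz0 : z ≠ 0 := norm_pos_iff.1 (hz ▸ one_pos)
  rw [arPoly_eq_smul_charPoly p A hz0]
  exact (hQ z⁻¹ (by rw [norm_inv, hz, inv_one])).smul (Units.mk0 _ (pow_ne_zero p hz0))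

theorem differentiable_arPoly (p : ℕ) (A : ℕ → E →L[ℂ] E) : Differentiable ℂ (arPoly p A) := by
  unfold arPoly
  fun_prop

theorem differentiable_maPoly (q : ℕ) (B : ℕ → E →L[ℂ] E) : Differentiable ℂ (maPoly q B) := by
  unfold maPoly
  fun_prop

/-- An open set containing the unit circle contains an annulus around it. -/
theorem exists_annulus_subset {U : Set ℂ} (hU : IsOpen U) (h : Metric.sphere (0 : ℂ) 1 ⊆ U) :
    ∃ r R : ℝ, 0 ≤ r ∧ r < 1 ∧ 1 < R ∧ annulus r R ⊆ U := by
  obtain ⟨δ, hδ, hsub⟩ := (isCompact_sphere (0 : ℂ) 1).exists_thickening_subset_open hU h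
  refine ⟨max 0 (1 - δ), 1 + δ, le_max_left _ _, max_lt one_pos (by linarith), by linarith,
    fun z hz => hsub ?_⟩
  have hz0 : 0 < ‖z‖ := (le_max_left _ _).trans_lt hz.1
  have hz1 : 1 - δ < ‖z‖ := (le_max_right _ _).trans_lt hz.1
  have hne : (‖z‖ : ℂ) ≠ 0 := by exact_mod_cast hz0.ne'
  -- The radial projection of `z` to the unit circle lies at distance `|‖z‖ - 1| < δ`.
  refine Metric.mem_thickening_iff.2 ⟨z / ‖z‖, ?_, ?_⟩
  · rw [mem_sphere_zero_iff_norm, norm_div, Complex.norm_real, norm_norm, div_self hz0.ne']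
  · have : z - z / ‖z‖ = (z / ‖z‖) * ((‖z‖ - 1 : ℝ) : ℂ) := by
      push_cast
      field_simp
    rw [dist_eq_norm, this, norm_mul, norm_div, Complex.norm_real, norm_norm, div_self hz0.ne',
      one_mul, Complex.norm_real, Real.norm_eq_abs, abs_lt]
    exact ⟨by linarith, by linarith [hz.2]⟩

theorem exists_annulus_isUnit_arPoly [CompleteSpace E] {p : ℕ} {A : ℕ → E →L[ℂ] E}
    (hQ : ∀ z : ℂ, ‖z‖ = 1 → IsUnit (charPoly p A z)) :
    ∃ r R : ℝ, 0 ≤ r ∧ r < 1 ∧ 1 < R ∧ ∀ z ∈ annulus r R, IsUnit (arPoly p A z) :=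
  exists_annulus_subset (Units.isOpen.preimage (differentiable_arPoly p A).continuous)
    fun _ hz => isUnit_arPoly_of_norm_eq_one hQ (mem_sphere_zero_iff_norm.1 hz)

theorem differentiableOn_inverse_arPoly [CompleteSpace E] {p : ℕ} {A : ℕ → E →L[ℂ] E} {U : Set ℂ}
    (h : ∀ z ∈ U, IsUnit (arPoly p A z)) :
    DifferentiableOn ℂ (fun z => Ring.inverse (arPoly p A z)) U := fun z hz =>
  ((differentiableAt_inverse (h z hz)).comp z
    (differentiable_arPoly p A z)).differentiableWithinAt

theorem differentiableOn_transfer [CompleteSpace E] {p q : ℕ} {A B : ℕ → E →L[ℂ] E} {U : Set ℂ}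
    (h : ∀ z ∈ U, IsUnit (arPoly p A z)) : DifferentiableOn ℂ (transfer p q A B) U :=
  (differentiableOn_inverse_arPoly h).mul (differentiable_maPoly q B).differentiableOn

variable {X : Type*} [NormedAddCommGroup X] [NormedSpace ℂ X]

theorem HasLaurentSeriesOn.on_sphere {f : ℂ → X} {φ : ℤ → X} {r R : ℝ} (hr1 : r < 1) (hR1 : 1 < R)
    (h : HasLaurentSeriesOn f φ r R) :
    (Summable fun k => ‖φ k‖) ∧ ∀ z : ℂ, ‖z‖ = 1 → HasSum (fun k : ℤ => z ^ k • φ k) (f z) := by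
  refine ⟨?_, fun z hz => (h z ⟨hz ▸ hr1, hz ▸ hR1⟩).2⟩
  simpa using (h 1 ⟨by simpa, by simpa⟩).1

theorem exists_norm_laurentCoeff_le_geometric {r R : ℝ} (hr : 0 ≤ r) (hr1 : r < 1) (hR1 : 1 < R)
    {f : ℂ → X} (hf : DifferentiableOn ℂ f (annulus r R)) :
    ∃ C s : ℝ, 0 < s ∧ s < 1 ∧ ∀ k : ℤ, ‖laurentCoeff f k‖ ≤ C * s ^ k.natAbs := by
  have hR0 : 0 < R := one_pos.trans hR1
  -- With `s` above both `r` and `R⁻¹`, the circles of radius `s` and `s⁻¹` lie in the annulus; the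
  -- first controls `k ≤ 0`, the second `k ≥ 0`.
  obtain ⟨s, hs, hs1⟩ := exists_between (max_lt hr1 (inv_lt_one_of_one_lt₀ hR1))
  have hrs : r < s := (le_max_left _ _).trans_lt hs
  have hs0 : 0 < s := hr.trans_lt hrs
  have hsR : s⁻¹ < R := inv_lt_of_inv_lt₀ hR0 ((le_max_right _ _).trans_lt hs)
  have hs1' : 1 < s⁻¹ := (one_lt_inv₀ hs0).2 hs1
  obtain ⟨M, hM0, -, hM⟩ := exists_norm_laurentCoeff_le hr hr1 hR1 hf hrs (hs1.trans hR1)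
  obtain ⟨N, hN0, -, hN⟩ := exists_norm_laurentCoeff_le hr hr1 hR1 hf (hr1.trans hs1') hsR
  refine ⟨max M N, s, hs0, hs1, fun k => ?_⟩
  rcases le_total 0 k with hk | hk
  · obtain ⟨n, rfl⟩ := Int.eq_ofNat_of_zero_le hk
    refine (hN _).trans ?_
    rw [inv_zpow', neg_neg, zpow_natCast, Int.natAbs_natCast]
    exact mul_le_mul_of_nonneg_right (le_max_right _ _) (by positivity)
  · obtain ⟨n, hn⟩ := Int.exists_eq_neg_ofNat hk
    subst hn
    refine (hM _).trans ?_
    rw [neg_neg, zpow_natCast, Int.natAbs_neg, Int.natAbs_natCast]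
    exact mul_le_mul_of_nonneg_right (le_max_left _ _) (by positivity)

theorem hasSum_zpow_smul_shift {φ : ℤ → X} {z : ℂ} (hz : z ≠ 0) {a : X}
    (h : HasSum (fun k : ℤ => z ^ k • φ k) a) (j : ℕ) :
    HasSum (fun k : ℤ => z ^ k • φ (k - j)) (z ^ j • a) := by
  have := (Equiv.subRight (j : ℤ)).hasSum_iff.2 (h.const_smul (z ^ j))
  refine this.congr_fun fun k => ?_
  simp only [Function.comp, Equiv.subRight_apply, smul_smul]
  rw [← zpow_natCast z j, ← zpow_add₀ hz, add_sub_cancel]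

theorem summable_norm_shift {X : Type*} [NormedAddCommGroup X] {φ : ℤ → X} (h : Summable fun k => ‖φ k‖) (j : ℤ) :
    Summable fun k => ‖φ (k - j)‖ :=
  (Equiv.subRight j).summable_iff.2 h

/-- The recursion for the coefficients of `transfer p q A B`. -/
theorem sub_sum_mul_eq [CompleteSpace E] {p q : ℕ} {A B : ℕ → E →L[ℂ] E} {φ : ℤ → E →L[ℂ] E}
    (hA : ∀ z : ℂ, ‖z‖ = 1 → IsUnit (arPoly p A z)) (hφ : Summable fun k => ‖φ k‖)
    (h : ∀ z : ℂ, ‖z‖ = 1 → HasSum (fun k : ℤ => z ^ k • φ k) (transfer p q A B z)) (k : ℤ) :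
    φ k - ∑ j ∈ Finset.Icc 1 p, A j * φ (k - j)
      = ∑ m ∈ Finset.range (q + 1), if k = m then B m else 0 := by
  -- Both sides are coefficient families of series for `maPoly q B`: on the left since `arPoly *
  -- transfer = maPoly`, on the right by inspection. Uniqueness of coefficients identifies them.
  have hL : (fun k : ℤ => φ k - ∑ j ∈ Finset.Icc 1 p, A j * φ (k - j)) k
      = laurentCoeff (maPoly q B) k := by
    refine eq_laurentCoeff_of_hasSum (X := E →L[ℂ] E)
      (φ := fun k : ℤ => φ k - ∑ j ∈ Finset.Icc 1 p, A j * φ (k - j))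
      (f := maPoly q B) ?_ (fun z hz => ?_) k
    · refine Summable.of_nonneg_of_le (fun k => norm_nonneg _)
        (fun k => (norm_sub_le _ _).trans (add_le_add_right
          ((norm_sum_le _ _).trans (Finset.sum_le_sum fun j _ => norm_mul_le _ _)) _)) ?_
      exact hφ.add (summable_sum fun j _ => (summable_norm_shift hφ _).mul_left _)
    · have hz0 : z ≠ 0 := norm_pos_iff.1 (hz ▸ one_pos)
      have h1 := (h z hz).sub (hasSum_sum (s := Finset.Icc 1 p) fun j _ =>
        (hasSum_zpow_smul_shift hz0 (h z hz) j).mul_left (A j))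
      have h2 : transfer p q A B z - ∑ j ∈ Finset.Icc 1 p, A j * z ^ j • transfer p q A B z
          = maPoly q B z := by
        have : arPoly p A z * transfer p q A B z = maPoly q B z := by
          rw [transfer, Ring.mul_inverse_cancel_left _ _ (hA z hz)]
        rw [← this, arPoly, sub_mul, Finset.sum_mul]
        simp only [mul_smul_comm, smul_mul_assoc]
        rfl
      rw [h2] at h1
      refine h1.congr_fun fun k => ?_
      simp only [smul_sub, Finset.smul_sum, mul_smul_comm]
  have hR : (fun k : ℤ => ∑ m ∈ Finset.range (q + 1), if k = (m : ℤ) then B m else 0) k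
      = laurentCoeff (maPoly q B) k := by
    refine eq_laurentCoeff_of_hasSum (X := E →L[ℂ] E)
      (φ := fun k : ℤ => ∑ m ∈ Finset.range (q + 1), if k = (m : ℤ) then B m else 0)
      (f := maPoly q B) ?_ (fun z hz => ?_) k
    · refine Summable.of_nonneg_of_le (fun k => norm_nonneg _) (fun k => norm_sum_le _ _)
        (summable_sum fun m _ => (hasSum_ite_eq (m : ℤ) ‖B m‖).summable.congr fun k => ?_)
      split_ifs <;> simp
    · have := hasSum_sum (s := Finset.range (q + 1)) fun m _ =>
        hasSum_ite_eq (m : ℤ) (z ^ m • B m)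
      refine this.congr_fun fun k => ?_
      rw [Finset.smul_sum]
      refine Finset.sum_congr rfl fun m _ => ?_
      split_ifs with h
      · rw [h, zpow_natCast]
      · rw [smul_zero]
  exact hL.trans hR.symm

/-- The recursion for the coefficients of the inverse of `arPoly p A`. -/
theorem sub_sum_mul_eq_ite [CompleteSpace E] {p : ℕ} {A : ℕ → E →L[ℂ] E} {d : ℤ → E →L[ℂ] E}
    (hA : ∀ z : ℂ, ‖z‖ = 1 → IsUnit (arPoly p A z)) (hd : Summable fun k => ‖d k‖)
    (h : ∀ z : ℂ, ‖z‖ = 1 → HasSum (fun k : ℤ => z ^ k • d k) (Ring.inverse (arPoly p A z)))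
    (k : ℤ) :
    d k - ∑ j ∈ Finset.Icc 1 p, d (k - j) * A j = if k = 0 then 1 else 0 := by
  -- Here the product is `inverse * arPoly = 1`, with `A j` on the right: recovering a solution from
  -- the homogeneous equation needs a left inverse.
  have hL : (fun k : ℤ => d k - ∑ j ∈ Finset.Icc 1 p, d (k - j) * A j) k
      = laurentCoeff (fun _ => (1 : E →L[ℂ] E)) k := by
    refine eq_laurentCoeff_of_hasSum (X := E →L[ℂ] E)
      (φ := fun k : ℤ => d k - ∑ j ∈ Finset.Icc 1 p, d (k - j) * A j)
      (f := fun _ => 1) ?_ (fun z hz => ?_) k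
    · refine Summable.of_nonneg_of_le (fun k => norm_nonneg _)
        (fun k => (norm_sub_le _ _).trans (add_le_add_right
          ((norm_sum_le _ _).trans (Finset.sum_le_sum fun j _ => norm_mul_le _ _)) _)) ?_
      exact hd.add (summable_sum fun j _ => (summable_norm_shift hd _).mul_right _)
    · have hz0 : z ≠ 0 := norm_pos_iff.1 (hz ▸ one_pos)
      have h1 := (h z hz).sub (hasSum_sum (s := Finset.Icc 1 p) fun j _ =>
        (hasSum_zpow_smul_shift hz0 (h z hz) j).mul_right (A j))
      have h2 : Ring.inverse (arPoly p A z)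
          - ∑ j ∈ Finset.Icc 1 p, z ^ j • Ring.inverse (arPoly p A z) * A j = 1 := by
        conv_rhs => rw [← Ring.inverse_mul_cancel _ (hA z hz)]
        conv_rhs => arg 2; rw [arPoly]
        rw [mul_sub, Finset.mul_sum]
        simp only [mul_smul_comm, smul_mul_assoc]
        rfl
      rw [h2] at h1
      refine h1.congr_fun fun k => ?_
      simp only [smul_sub, Finset.smul_sum, smul_mul_assoc]
  have hR : (fun k : ℤ => if k = 0 then (1 : E →L[ℂ] E) else 0) k
      = laurentCoeff (fun _ => (1 : E →L[ℂ] E)) k := by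
    refine eq_laurentCoeff_of_hasSum (X := E →L[ℂ] E)
      (φ := fun k : ℤ => if k = 0 then (1 : E →L[ℂ] E) else 0)
      (f := fun _ => 1) ?_ (fun z hz => ?_) k
    · refine (hasSum_ite_eq (0 : ℤ) ‖(1 : E →L[ℂ] E)‖).summable.congr fun k => ?_
      split_ifs <;> simp
    · refine (hasSum_ite_eq (0 : ℤ) (1 : E →L[ℂ] E)).congr_fun fun k => ?_
      split_ifs with h
      · rw [h, zpow_zero, one_smul]
      · rw [smul_zero]
  exact hL.trans hR.symm

end Filter

end ARMA

/-! ### Convergence to zero in measure -/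

section ConvergenceInMeasure

variable {Ω E F : Type*} [MeasurableSpace Ω] [NormedAddCommGroup E] {P : Measure Ω}

theorem tendstoInMeasure_zero_add {f g : ℕ → Ω → E}
    (hf : TendstoInMeasure P f Filter.atTop fun _ => 0)
    (hg : TendstoInMeasure P g Filter.atTop fun _ => 0) :
    TendstoInMeasure P (fun n ω => f n ω + g n ω) Filter.atTop fun _ => 0 := by
  rw [tendstoInMeasure_iff_norm] at *
  intro ε hε
  have h := (hf (ε / 2) (half_pos hε)).add (hg (ε / 2) (half_pos hε))
  rw [add_zero] at h
  refine tendsto_of_tendsto_of_tendsto_of_le_of_le tendsto_const_nhds h (fun _ => zero_le)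
    fun n => (measure_mono fun ω hω => ?_).trans (measure_union_le _ _)
  simp only [sub_zero, Set.mem_ofPred_eq, Set.mem_union] at hω ⊢
  by_contra! hcon
  linarith [norm_add_le (f n ω) (g n ω), hcon.1, hcon.2]

theorem tendstoInMeasure_zero_sum {ι : Type*} (s : Finset ι) {f : ι → ℕ → Ω → E}
    (hf : ∀ i ∈ s, TendstoInMeasure P (f i) Filter.atTop fun _ => 0) :
    TendstoInMeasure P (fun n ω => ∑ i ∈ s, f i n ω) Filter.atTop fun _ => 0 := by
  classical
  induction s using Finset.induction_on with
  | empty =>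
    intro ε hε
    simp [hε.ne']
  | insert i s his ih =>
    simp only [Finset.sum_insert his]
    exact tendstoInMeasure_zero_add (hf i (Finset.mem_insert_self _ _))
      (ih fun j hj => hf j (Finset.mem_insert_of_mem hj))

/-- Operators tending to zero, applied to identically distributed variables, tend to zero in
measure. -/
theorem tendstoInMeasure_clm_apply [NormedSpace ℂ E] [MeasurableSpace E] [BorelSpace E]
    [IsFiniteMeasure P] {Y : ℤ → Ω → E} (hY : ∀ t, IdentDistrib (Y t) (Y 0) P P)
    {c : ℕ → E →L[ℂ] E} (hc : Filter.Tendsto c Filter.atTop (nhds 0)) (τ : ℕ → ℤ) :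
    TendstoInMeasure P (fun n ω => c n (Y (τ n) ω)) Filter.atTop fun _ => 0 := by
  -- For the fixed variable `Y 0` the convergence is pointwise; equality of laws then transfers the
  -- tail probabilities to `Y (τ n)`.
  have h0 : TendstoInMeasure P (fun n ω => ‖c n‖ * ‖Y 0 ω‖) Filter.atTop fun _ => (0 : ℝ) := by
    refine tendstoInMeasure_of_tendsto_ae (fun n => ?_) (Filter.Eventually.of_forall fun ω => ?_)
    · exact ((hY 0).aemeasurable_fst.norm.const_mul _).aestronglyMeasurable
    · simpa using hc.norm.mul_const ‖Y 0 ω‖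
  rw [tendstoInMeasure_iff_norm] at *
  intro ε hε
  refine tendsto_of_tendsto_of_tendsto_of_le_of_le tendsto_const_nhds (h0 ε hε)
    (fun _ => zero_le) fun n => ?_
  have hset : MeasurableSet {x : E | ε ≤ ‖c n‖ * ‖x‖} :=
    measurableSet_le measurable_const (measurable_norm.const_mul _)
  calc P {ω | ε ≤ ‖c n (Y (τ n) ω) - 0‖}
      ≤ P (Y (τ n) ⁻¹' {x : E | ε ≤ ‖c n‖ * ‖x‖}) := by
        refine measure_mono fun ω hω => ?_
        simp only [sub_zero, Set.mem_ofPred_eq] at hω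
        exact hω.trans ((c n).le_opNorm _)
    _ = P (Y 0 ⁻¹' {x : E | ε ≤ ‖c n‖ * ‖x‖}) := (hY (τ n)).measure_preimage_eq hset
    _ = P {ω | ε ≤ ‖‖c n‖ * ‖Y 0 ω‖ - 0‖} := by
        congr 1
        ext ω
        simp

end ConvergenceInMeasure

namespace ARMA

/-! ### Growth of the noise and convergence of the series -/

section Growth

variable {Ω E : Type*} [MeasurableSpace Ω] [NormedAddCommGroup E] [MeasurableSpace E]
  [BorelSpace E] {P : Measure Ω} [IsProbabilityMeasure P] {Z : ℤ → Ω → E}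

/-- Identically distributed variables with a logarithmic moment grow subexponentially. -/
theorem ae_eventually_norm_le_exp (hZ : ∀ t, IdentDistrib (Z t) (Z 0) P P)
    (hlog : Integrable (fun ω => log⁺ ‖Z 0 ω‖) P) {δ : ℝ} (hδ : 0 < δ) (τ : ℕ → ℤ) :
    ∀ᵐ ω ∂P, ∀ᶠ n : ℕ in Filter.atTop, ‖Z (τ n) ω‖ ≤ exp (δ * n) := by
  let _ : MeasureSpace Ω := ⟨P⟩
  have : IsProbabilityMeasure (volume : Measure Ω) := ‹IsProbabilityMeasure P›
  -- Integrability of `log⁺ ‖Z 0‖ / δ` makes its tail probabilities at the integers summable, as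
  -- Borel–Cantelli requires.
  have hsum := tsum_prob_mem_Ioi_lt_top (Ω := Ω) (X := fun ω => log⁺ ‖Z 0 ω‖ / δ)
    (hlog.div_const δ) (fun ω => div_nonneg posLog_nonneg hδ.le)
  have hle : ∀ n : ℕ, P {ω | exp (δ * n) < ‖Z (τ n) ω‖}
      ≤ P {ω | log⁺ ‖Z 0 ω‖ / δ ∈ Set.Ioi (n : ℝ)} := by
    intro n
    have hset : MeasurableSet {x : E | exp (δ * n) < ‖x‖} :=
      measurableSet_lt measurable_const measurable_norm
    refine ((hZ (τ n)).measure_preimage_eq hset).trans_le (measure_mono fun ω hω => ?_)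
    have hω' : exp (δ * n) < ‖Z 0 ω‖ := hω
    rw [Set.mem_ofPred_eq, Set.mem_Ioi, lt_div_iff₀ hδ, mul_comm]
    have hpos : 0 < ‖Z 0 ω‖ := (exp_pos _).trans hω'
    exact ((lt_log_iff_exp_lt hpos).2 hω').trans_le (le_max_right _ _)
  have hfin : ∑' n : ℕ, P {ω | exp (δ * n) < ‖Z (τ n) ω‖} ≠ ⊤ :=
    ((ENNReal.tsum_le_tsum hle).trans_lt hsum).ne
  filter_upwards [ae_eventually_notMem hfin] with ω hω
  exact hω.mono fun n hn => not_lt.1 hn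

/-- Since `exp (-log s / 2) = s ^ (-1/2)`, growth at this rate consumes only half of the decay and
leaves the ratio `√s < 1`. -/
theorem summable_geometric_mul_exp {C s : ℝ} (hs : 0 < s) (hs1 : s < 1) :
    Summable fun n : ℕ => C * s ^ n * exp (-log s / 2 * n) := by
  have hlt : s * exp (-log s / 2) < 1 := by
    have h : s = exp (log s) := (exp_log hs).symm
    have hl : log s < 0 := log_neg hs hs1
    conv_lhs => arg 1; rw [h]
    rw [← exp_add, exp_lt_one_iff]
    linarith
  refine ((summable_geometric_of_lt_one (by positivity) hlt).mul_left C).congr fun n => ?_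
  rw [mul_pow, ← exp_nat_mul, mul_comm (n : ℝ), mul_assoc]

theorem ae_summable_norm_apply [NormedSpace ℂ E] (hZ : ∀ t, IdentDistrib (Z t) (Z 0) P P)
    (hlog : Integrable (fun ω => log⁺ ‖Z 0 ω‖) P) {ψ : ℤ → E →L[ℂ] E} {C s : ℝ} (hs : 0 < s)
    (hs1 : s < 1) (hψ : ∀ k : ℤ, ‖ψ k‖ ≤ C * s ^ k.natAbs) (t : ℤ) :
    ∀ᵐ ω ∂P, Summable fun k : ℤ => ‖ψ k (Z (t - k) ω)‖ := by
  have hδ : 0 < -log s / 2 := by linarith [log_neg hs hs1]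
  filter_upwards [ae_eventually_norm_le_exp hZ hlog hδ fun n => t - n,
    ae_eventually_norm_le_exp hZ hlog hδ fun n => t - -n] with ω h1 h2
  refine Summable.of_nat_of_neg ?_ ?_
  · refine (summable_geometric_mul_exp (C := C) hs hs1).of_norm_bounded_eventually_nat ?_
    filter_upwards [h1] with n hn
    rw [norm_norm]
    refine ((ψ n).le_opNorm _).trans (mul_le_mul (hψ n) hn (norm_nonneg _) ?_)
    exact (norm_nonneg _).trans (hψ n)
  · refine (summable_geometric_mul_exp (C := C) hs hs1).of_norm_bounded_eventually_nat ?_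
    filter_upwards [h2] with n hn
    have hb := hψ (-n)
    rw [Int.natAbs_neg, Int.natAbs_natCast] at hb
    rw [norm_norm]
    exact ((ψ _).le_opNorm _).trans
      (mul_le_mul hb hn (norm_nonneg _) ((norm_nonneg _).trans hb))

end Growth

/-! ### Strict stationarity -/

section Stationary

variable {Ω E : Type*} [MeasurableSpace Ω] [MeasurableSpace E] {P : Measure Ω} {Z : ℤ → Ω → E}

theorem IsStrictlyStationary.identDistrib {Y : ℤ → Ω → E} (hY : IsStrictlyStationary Y P) (t : ℤ) :
    IdentDistrib (Y t) (Y 0) P P := by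
  refine ⟨(hY.measurable t).aemeasurable, (hY.measurable 0).aemeasurable, ?_⟩
  have h := congrArg (Measure.map fun x : ℤ → E => x 0) (hY.shift t)
  rw [Measure.map_map (measurable_pi_apply 0) (measurable_pi_lambda _ fun s => hY.measurable _),
    Measure.map_map (measurable_pi_apply 0) (measurable_pi_lambda _ fun s => hY.measurable _)] at h
  simpa [Function.comp_def] using h

/-- The joint law of an i.i.d. family is the product of its marginals, which a shift leaves
unchanged. -/
theorem IsStrictWhiteNoise.isStrictlyStationary [IsProbabilityMeasure P]
    (hZ : IsStrictWhiteNoise Z P) : IsStrictlyStationary Z P := by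
  refine ⟨hZ.measurable, fun h => ?_⟩
  rw [hZ.indep.map_fun_eq_infinitePi_map hZ.measurable,
    (hZ.indep.precomp (add_left_injective h)).map_fun_eq_infinitePi_map
      fun t => hZ.measurable (t + h)]
  congr 1
  funext t
  exact ((hZ.identDistrib (t + h)).trans (hZ.identDistrib t).symm).map_eq

/-- A moving average of a strictly stationary process is strictly stationary. -/
theorem IsStrictlyStationary.tsum_apply {E : Type*} [NormedAddCommGroup E] [NormedSpace ℂ E]
    [CompleteSpace E] [TopologicalSpace.SeparableSpace E] [MeasurableSpace E] [BorelSpace E]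
    {Z : ℤ → Ω → E} (hZ : IsStrictlyStationary Z P) (ψ : ℤ → E →L[ℂ] E) :
    IsStrictlyStationary (fun t ω => ∑' k : ℤ, ψ k (Z (t - k) ω)) P := by
  have : SecondCountableTopology E := UniformSpace.secondCountable_of_separable E
  refine ⟨fun t => Measurable.tsum fun k => (ψ k).measurable.comp (hZ.measurable _), fun h => ?_⟩
  -- As `tsum` is `0` where the series is not summable, the filter is a measurable map on all of `ℤ
  -- → E`, and it commutes with shifts.
  have hG : Measurable fun (x : ℤ → E) (t : ℤ) => ∑' k : ℤ, ψ k (x (t - k)) :=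
    measurable_pi_lambda _ fun t =>
      Measurable.tsum fun k => (ψ k).measurable.comp (measurable_pi_apply _)
  have hm := congrArg (Measure.map fun (x : ℤ → E) (t : ℤ) => ∑' k : ℤ, ψ k (x (t - k)))
    (hZ.shift h)
  rw [Measure.map_map hG (measurable_pi_lambda _ fun s => hZ.measurable _),
    Measure.map_map hG (measurable_pi_lambda _ fun s => hZ.measurable _)] at hm
  simpa only [Function.comp_def, sub_add_eq_add_sub] using hm

end Stationary

end ARMA

namespace ARMA

/-! ### Uniqueness of the stationary solution -/

section Uniqueness

variable {Ω E : Type*} [MeasurableSpace Ω] [NormedAddCommGroup E] [NormedSpace ℂ E]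
  {P : Measure Ω}

/-- Moving a window by `j` brings in `j` terms at its right end and drops `j` at its left end. -/
theorem sum_range_shift {G : Type*} [AddCommGroup G] (f : ℤ → G) (N : ℕ) (a : ℤ) (j : ℕ) :
    ∑ i ∈ Finset.range N, f (a + i + j)
      = ∑ i ∈ Finset.range N, f (a + i)
        + ∑ l ∈ Finset.range j, (f (a + N + l) - f (a + l)) := by
  induction j with
  | zero => simp
  | succ j ih =>
    rw [Finset.sum_range_succ, ← add_assoc, ← ih, ← sub_eq_iff_eq_add', ← Finset.sum_sub_distrib]
    have h := Finset.sum_range_sub (fun i : ℕ => f (a + i + j)) N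
    rw [Nat.cast_zero, add_zero] at h
    rw [← h]
    refine Finset.sum_congr rfl fun i _ => ?_
    congr 2
    push_cast
    ring

/-- A solution of the homogeneous recursion is, for every window, a sum of boundary terms. -/
theorem eq_boundary_sum {p : ℕ} {A : ℕ → E →L[ℂ] E} {d : ℤ → E →L[ℂ] E}
    (hd : ∀ k : ℤ, d k - ∑ j ∈ Finset.Icc 1 p, d (k - j) * A j = if k = 0 then 1 else 0)
    {w : ℤ → E} (hw : ∀ t : ℤ, w t - ∑ j ∈ Finset.Icc 1 p, A j (w (t - j)) = 0) (t : ℤ) (n : ℕ) :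
    w t = ∑ j ∈ Finset.Icc 1 p, ∑ l ∈ Finset.range j,
      ((d (n + 1 + l - j) * A j) (w (t - (n + 1 + l)))
        + (-(d (-n + l - j) * A j)) (w (t - (-n + l)))) := by
  -- Each `w` is replaced by its recursion. The form `-n + i + j - j` displays the summand as a
  -- translate by `j`, ready for `sum_range_shift`.
  have h0 : ∑ i ∈ Finset.range (2 * n + 1), d (-n + i) (w (t - (-n + i)))
      = ∑ j ∈ Finset.Icc 1 p, ∑ i ∈ Finset.range (2 * n + 1),
          (d (-n + i + j - j) * A j) (w (t - (-n + i + j))) := by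
    rw [Finset.sum_comm]
    refine Finset.sum_congr rfl fun i _ => ?_
    rw [sub_eq_zero.1 (hw (t - (-n + i))), map_sum]
    refine Finset.sum_congr rfl fun j _ => ?_
    rw [add_sub_cancel_right, sub_sub t]
    rfl
  -- The recursion for `d` annihilates every index of the window except `k = 0`, that is `i = n`.
  have h1 : ∑ i ∈ Finset.range (2 * n + 1), d (-n + i) (w (t - (-n + i)))
      - ∑ j ∈ Finset.Icc 1 p, ∑ i ∈ Finset.range (2 * n + 1),
          (d (-n + i - j) * A j) (w (t - (-n + i))) = w t := by
    rw [Finset.sum_comm, ← Finset.sum_sub_distrib]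
    rw [Finset.sum_eq_single_of_mem n (Finset.mem_range.2 (by omega))]
    · have := congrArg (fun T : E →L[ℂ] E => T (w (t - (-n + n)))) (hd (-n + n))
      simpa [sum_apply] using this
    · intro i _ hi
      have := congrArg (fun T : E →L[ℂ] E => T (w (t - (-n + i)))) (hd (-n + i))
      rw [if_neg (by omega)] at this
      simpa [sum_apply] using this
  have h2 : ∀ j : ℕ, ∑ i ∈ Finset.range (2 * n + 1),
        (d (-n + i + j - j) * A j) (w (t - (-n + i + j)))
      = ∑ i ∈ Finset.range (2 * n + 1), (d (-n + i - j) * A j) (w (t - (-n + i)))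
        + ∑ l ∈ Finset.range j, ((d (n + 1 + l - j) * A j) (w (t - (n + 1 + l)))
          + (-(d (-n + l - j) * A j)) (w (t - (-n + l)))) := by
    intro j
    rw [sum_range_shift (fun m : ℤ => (d (m - j) * A j) (w (t - m))) (2 * n + 1) (-n) j]
    congr 1
    refine Finset.sum_congr rfl fun l _ => ?_
    have : (-n + ((2 * n + 1 : ℕ) : ℤ) + l) = n + 1 + l := by push_cast; ring
    rw [this, sub_eq_add_neg]
    rfl
  rw [h0, Finset.sum_congr rfl fun j _ => h2 j, Finset.sum_add_distrib, add_sub_cancel_left] at h1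
  exact h1.symm

theorem tendsto_comp_of_summable {X : Type*} [NormedAddCommGroup X] {d : ℤ → X}
    (hd : Summable fun k => ‖d k‖) {τ : ℕ → ℤ} (hτ : Function.Injective τ) :
    Filter.Tendsto (fun n => d (τ n)) Filter.atTop (nhds 0) :=
  tendsto_zero_iff_norm_tendsto_zero.2 (hd.comp_injective hτ).tendsto_atTop_zero

/-- Two solutions, each with identical marginal distributions, agree almost surely. -/
theorem IsSolution.ae_eq [MeasurableSpace E] [BorelSpace E] [IsFiniteMeasure P] {p q : ℕ}
    {A B : ℕ → E →L[ℂ] E} {Z Y Y' : ℤ → Ω → E} (hY : ∀ t, IdentDistrib (Y t) (Y 0) P P)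
    (hY' : ∀ t, IdentDistrib (Y' t) (Y' 0) P P) (hsol : IsSolution p q A B Z Y P)
    (hsol' : IsSolution p q A B Z Y' P) {d : ℤ → E →L[ℂ] E} (hdsum : Summable fun k => ‖d k‖)
    (hd : ∀ k : ℤ, d k - ∑ j ∈ Finset.Icc 1 p, d (k - j) * A j = if k = 0 then 1 else 0) :
    ∀ᵐ ω ∂P, ∀ t : ℤ, Y t ω = Y' t ω := by
  have hrec : ∀ᵐ ω ∂P, ∀ t : ℤ,
      (Y t ω - Y' t ω) - ∑ j ∈ Finset.Icc 1 p, A j (Y (t - j) ω - Y' (t - j) ω) = 0 := by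
    filter_upwards [ae_all_iff.2 hsol, ae_all_iff.2 hsol'] with ω h h' t
    simp only [map_sub, Finset.sum_sub_distrib]
    rw [sub_sub_sub_comm, h t, h' t, sub_self]
  -- The joint law of `Y` and `Y'` is not controlled, so their difference need not have identical
  -- marginals; each process is treated separately.
  have hlim : ∀ c : ℕ → E →L[ℂ] E, Filter.Tendsto c Filter.atTop (nhds 0) → ∀ τ : ℕ → ℤ,
      TendstoInMeasure P (fun n ω => c n (Y (τ n) ω - Y' (τ n) ω)) Filter.atTop fun _ => 0 := by
    intro c hc τ
    have hc' : Filter.Tendsto (fun n => -c n) Filter.atTop (nhds 0) := by simpa using hc.neg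
    refine (tendstoInMeasure_zero_add (tendstoInMeasure_clm_apply hY hc τ)
      (tendstoInMeasure_clm_apply hY' hc' τ)).congr_left fun n => ?_
    refine Filter.Eventually.of_forall fun ω => ?_
    simp [sub_eq_add_neg]
  have hmul : ∀ (j : ℕ) {τ : ℕ → ℤ}, Function.Injective τ →
      Filter.Tendsto (fun n => d (τ n) * A j) Filter.atTop (nhds 0) := fun j τ hτ => by
    simpa using (tendsto_comp_of_summable hdsum hτ).mul_const (A j)
  rw [ae_all_iff]
  intro t
  -- The boundary sum equals `Y t - Y' t` almost surely for every `n`, so this constant sequence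
  -- inherits the limit zero.
  have hzero : TendstoInMeasure P (fun (_ : ℕ) ω => Y t ω - Y' t ω) Filter.atTop fun _ => 0 := by
    refine (tendstoInMeasure_zero_sum (Finset.Icc 1 p) fun j _ =>
      tendstoInMeasure_zero_sum (Finset.range j) fun l _ => tendstoInMeasure_zero_add
        (hlim (fun n => d (n + 1 + l - j) * A j) (hmul j fun a b h => ?_)
          fun n => t - (n + 1 + l))
        (hlim (fun n => -(d (-n + l - j) * A j)) ?_ fun n => t - (-n + l))).congr_left fun n => ?_
    · simpa using h
    · have := (hmul j (τ := fun n : ℕ => -(n : ℤ) + l - j) fun a b h => by simpa using h).neg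
      simpa using this
    · filter_upwards [hrec] with ω hω
      exact (eq_boundary_sum hd (w := fun s => Y s ω - Y' s ω) hω t n).symm
  have hself : TendstoInMeasure P (fun (_ : ℕ) ω => Y t ω - Y' t ω) Filter.atTop
      fun ω => Y t ω - Y' t ω := by
    intro ε hε
    simp [hε.ne']
  filter_upwards [tendstoInMeasure_ae_unique hself hzero] with ω hω
  exact sub_eq_zero.1 hω

end Uniqueness

/-! ### The moving average solves the equation -/

section Existence

variable {Ω E : Type*} [MeasurableSpace Ω] [NormedAddCommGroup E] [NormedSpace ℂ E]
  [CompleteSpace E] {P : Measure Ω}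

theorem isSolution_tsum {p q : ℕ} {A B : ℕ → E →L[ℂ] E} {Z : ℤ → Ω → E} {ψ : ℤ → E →L[ℂ] E}
    (hψ : ∀ k : ℤ, ψ k - ∑ j ∈ Finset.Icc 1 p, A j * ψ (k - j)
      = ∑ m ∈ Finset.range (q + 1), if k = m then B m else 0)
    (hsum : ∀ t : ℤ, ∀ᵐ ω ∂P, Summable fun k : ℤ => ‖ψ k (Z (t - k) ω)‖) :
    IsSolution p q A B Z (fun t ω => ∑' k : ℤ, ψ k (Z (t - k) ω)) P := by
  intro t
  filter_upwards [ae_all_iff.2 hsum] with ω hω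
  have hY : ∀ t : ℤ, HasSum (fun k : ℤ => ψ k (Z (t - k) ω)) (∑' k : ℤ, ψ k (Z (t - k) ω)) :=
    fun t => (hω t).of_norm.hasSum
  have hshift : ∀ j : ℕ, HasSum (fun k : ℤ => (A j * ψ (k - j)) (Z (t - k) ω))
      (A j (∑' k : ℤ, ψ k (Z (t - j - k) ω))) := by
    intro j
    have := (Equiv.subRight (j : ℤ)).hasSum_iff.2 ((A j).hasSum (hY (t - j)))
    refine this.congr_fun fun k => ?_
    simp only [Function.comp, Equiv.subRight_apply, sub_sub, add_sub_cancel]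
    rfl
  have hleft := (hY t).sub (hasSum_sum (s := Finset.Icc 1 p) fun j _ => hshift j)
  have hright : HasSum (fun k : ℤ => (∑ m ∈ Finset.range (q + 1), if k = (m : ℤ) then B m else 0)
      (Z (t - k) ω)) (∑ m ∈ Finset.range (q + 1), B m (Z (t - m) ω)) := by
    have := hasSum_sum (s := Finset.range (q + 1)) fun m _ =>
      hasSum_ite_eq (m : ℤ) (B m (Z (t - m) ω))
    refine this.congr_fun fun k => ?_
    rw [sum_apply]
    refine Finset.sum_congr rfl fun m _ => ?_
    split_ifs with h
    · rw [h]
    · rfl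
  refine hleft.unique (hright.congr_fun fun k => ?_)
  rw [← hψ k, sub_apply, sum_apply]

end Existence

end ARMA

theorem theorem3 {E : Type*} [NormedAddCommGroup E] [NormedSpace ℂ E] [CompleteSpace E]
    [TopologicalSpace.SeparableSpace E] [MeasurableSpace E] [BorelSpace E]
    {Ω : Type*} [MeasurableSpace Ω] (P : Measure Ω) [IsProbabilityMeasure P]
    (p q : ℕ) (A B : ℕ → E →L[ℂ] E) (Z : ℤ → Ω → E)
    (hZ : ARMA.IsStrictWhiteNoise Z P)
    (hlog : Integrable (fun ω => log⁺ ‖Z 0 ω‖) P)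
    (hQ : ∀ z : ℂ, ‖z‖ = 1 → IsUnit (ARMA.charPoly p A z)) :
    ∃ ψ : ℤ → E →L[ℂ] E,
      -- `ψ` is the family of Laurent coefficients on an annulus containing the unit circle
      (∃ r R : ℝ, 0 ≤ r ∧ r < 1 ∧ 1 < R ∧
        (∀ z ∈ ARMA.annulus r R, IsUnit (ARMA.arPoly p A z)) ∧
        DifferentiableOn ℂ (ARMA.transfer p q A B) (ARMA.annulus r R) ∧
        ARMA.HasLaurentSeriesOn (ARMA.transfer p q A B) ψ r R) ∧
      -- these coefficients do not depend on the annulus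
      (∀ (φ : ℤ → E →L[ℂ] E) (r R : ℝ), 0 ≤ r → r < 1 → 1 < R →
        ARMA.HasLaurentSeriesOn (ARMA.transfer p q A B) φ r R → φ = ψ) ∧
      -- they are given by contour integrals over the unit circle
      (∀ n : ℤ, ψ n = (2 * (π : ℂ) * Complex.I)⁻¹ •
        ∮ z in C(0, 1), z ^ (-n - 1) • ARMA.transfer p q A B z) ∧
      -- the moving average series converges almost surely absolutely
      (∀ t : ℤ, ∀ᵐ ω ∂P, Summable (fun k : ℤ => ‖ψ k (Z (t - k) ω)‖)) ∧
      -- its sum is a strictly stationary solution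
      ARMA.IsStrictlyStationary (fun t ω => ∑' k : ℤ, ψ k (Z (t - k) ω)) P ∧
      ARMA.IsSolution p q A B Z (fun t ω => ∑' k : ℤ, ψ k (Z (t - k) ω)) P ∧
      -- and it is, almost surely, the only one
      (∀ Y : ℤ → Ω → E, ARMA.IsStrictlyStationary Y P → ARMA.IsSolution p q A B Z Y P →
        ∀ᵐ ω ∂P, ∀ t : ℤ, Y t ω = ∑' k : ℤ, ψ k (Z (t - k) ω)) := by
  obtain ⟨r, R, hr, hr1, hR1, hunit⟩ := ARMA.exists_annulus_isUnit_arPoly hQ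
  have hA : ∀ z : ℂ, ‖z‖ = 1 → IsUnit (ARMA.arPoly p A z) := fun z hz =>
    ARMA.isUnit_arPoly_of_norm_eq_one hQ hz
  have hF : DifferentiableOn ℂ (ARMA.transfer p q A B) (ARMA.annulus r R) :=
    ARMA.differentiableOn_transfer hunit
  -- The inverse alone is expanded as well: its coefficients are the kernel `d` of the uniqueness
  -- argument.
  have hD := ARMA.differentiableOn_inverse_arPoly hunit
  have hFL := ARMA.hasLaurentSeriesOn_laurentCoeff hr hr1 hR1 hF
  have hDL := ARMA.hasLaurentSeriesOn_laurentCoeff hr hr1 hR1 hD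
  obtain ⟨C, s, hs, hs1, hC⟩ := ARMA.exists_norm_laurentCoeff_le_geometric hr hr1 hR1 hF
  have hsum : ∀ t : ℤ, ∀ᵐ ω ∂P,
      Summable fun k : ℤ => ‖laurentCoeff (ARMA.transfer p q A B) k (Z (t - k) ω)‖ :=
    ARMA.ae_summable_norm_apply hZ.identDistrib hlog hs hs1 hC
  obtain ⟨hFs, hFe⟩ := hFL.on_sphere hr1 hR1
  obtain ⟨hDs, hDe⟩ := hDL.on_sphere hr1 hR1
  have hstat := hZ.isStrictlyStationary.tsum_apply (laurentCoeff (ARMA.transfer p q A B))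
  have hsol := ARMA.isSolution_tsum (ARMA.sub_sum_mul_eq hA hFs hFe) hsum
  refine ⟨laurentCoeff (ARMA.transfer p q A B), ⟨r, R, hr, hr1, hR1, hunit, hF, hFL⟩,
    fun φ r' R' _ hr' hR' hφ => ?_, fun n => rfl, hsum, hstat, hsol, fun Y hY hYsol => ?_⟩
  -- Every admissible annulus contains the unit circle, where the values of the sum already
  -- determine the coefficients.
  · obtain ⟨hs', he'⟩ := hφ.on_sphere hr' hR'
    exact funext fun n => eq_laurentCoeff_of_hasSum hs' he' n
  · exact hYsol.ae_eq hY.identDistrib hstat.identDistrib hsol hDs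
      (ARMA.sub_sum_mul_eq_ite hA hDs hDe)
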